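/- For a finite simple graph $G$, color a set $B \subseteq V(G)$ of vertices initially and fix a set $L \subseteq V(G)$ of leaks. A colored vertex $u \notin L$ may color (force) a neighbor $v$ when $v$ is the only uncolored neighbor of $u$; this rule is applied as long as possible. For an integer $\ell \ge 0$, $B$ is an $\ell$-leaky forcing set if for every set $L$ of at most $\ell$ leaks all vertices of $G$ are eventually colored. Let $Z_\ell(G)$ be the smallest cardinality of an $\ell$-leaky forcing set; $Z_0(G)$ is the zero forcing number. $G$ is called $\ell$-resilient if $Z_\ell(G) = Z_0(G)$. The direct product $G \times H$ has vertex set $V(G) \times V(H)$, with $(g,h)$ adjacent to $(g',h')$ if and only if $gg' \in E(G)$ and $hh' \in E(H)$. Theorem 2.3. Let $n \ge 2$ and $t \ge 3$ be integers, $K_n$ the complete graph on $n$ vertices and $C_t$ the cycle on $t$ vertices. Then $K_n \times C_t$ is $1$-resilient, and $$Z_1(K_n \times C_t) = Z_0(K_n \times C_t) = \begin{cases} (n-2)t + 2, & t \text{ odd},\\ (n-2)t + 4, & t \text{ even}. \end{cases}$$ -/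

import Mathlib

namespace LeakyForcing

/-- The direct (tensor, categorical) product of two simple graphs: `(g, h)` and `(g', h')` are
adjacent iff `g` is adjacent to `g'` and `h` is adjacent to `h'`. -/
def directProduct {V W : Type*} (G : SimpleGraph V) (H : SimpleGraph W) : SimpleGraph (V × W) where
  Adj x y := G.Adj x.1 y.1 ∧ H.Adj x.2 y.2
  symm := ⟨fun _ _ h => ⟨h.1.symm, h.2.symm⟩⟩
  loopless := ⟨fun _ h => G.irrefl h.1⟩

/-- `Colored G L B v`: the vertex `v` is eventually colored when the color change rule is iterated
from the initially colored set `B`, where the vertices of `L` are leaks, that is, they never force.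
A colored vertex `u` that is not a leak forces its neighbor `v` as soon as all neighbors of `u`
other than `v` are colored. -/
inductive Colored {V : Type*} (G : SimpleGraph V) (L B : Finset V) : V → Prop
  | initial (v : V) (hv : v ∈ B) : Colored G L B v
  | force (u v : V) (hu : Colored G L B u) (hleak : u ∉ L) (hadj : G.Adj u v)
      (hother : ∀ w, G.Adj u w → w ≠ v → Colored G L B w) : Colored G L B v

/-- `B` is a zero forcing set: without leaks, all vertices are eventually colored. -/
def IsZeroForcingSet {V : Type*} (G : SimpleGraph V) (B : Finset V) : Prop :=
  ∀ v, Colored G ∅ B v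

/-- `B` is an `ℓ`-leaky forcing set: whichever (at most) `ℓ` vertices are leaks, all vertices are
eventually colored. -/
def IsLeakyForcingSet {V : Type*} (G : SimpleGraph V) (ℓ : ℕ) (B : Finset V) : Prop :=
  ∀ L : Finset V, L.card ≤ ℓ → ∀ v, Colored G L B v

/-- The zero forcing number: the smallest cardinality of a zero forcing set. -/
noncomputable def zeroForcingNumber {V : Type*} [Fintype V] (G : SimpleGraph V) : ℕ :=
  sInf {k | ∃ B : Finset V, IsZeroForcingSet G B ∧ B.card = k}

/-- The `ℓ`-leaky forcing number: the smallest cardinality of an `ℓ`-leaky forcing set. -/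
noncomputable def leakyForcingNumber {V : Type*} [Fintype V] (G : SimpleGraph V) (ℓ : ℕ) : ℕ :=
  sInf {k | ∃ B : Finset V, IsLeakyForcingSet G ℓ B ∧ B.card = k}

/-- `G` is `ℓ`-resilient: its `ℓ`-leaky forcing number equals its zero forcing number. -/
def IsResilient {V : Type*} [Fintype V] (G : SimpleGraph V) (ℓ : ℕ) : Prop :=
  leakyForcingNumber G ℓ = zeroForcingNumber G

/-- The minimum defining the `ℓ`-leaky forcing number is over a nonempty set, hence attained. -/
theorem exists_leakyForcingSet_card {V : Type*} [Fintype V] (G : SimpleGraph V) (ℓ : ℕ) :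
    ∃ B : Finset V, IsLeakyForcingSet G ℓ B ∧ B.card = leakyForcingNumber G ℓ :=
  Nat.sInf_mem (s := {k | ∃ B : Finset V, IsLeakyForcingSet G ℓ B ∧ B.card = k})
    ⟨_, Finset.univ, fun _ _ v => .initial v (Finset.mem_univ v), rfl⟩

/-- Zero forcing is the case `ℓ = 0` of `ℓ`-leaky forcing. -/
theorem leakyForcingNumber_zero {V : Type*} [Fintype V] (G : SimpleGraph V) :
    leakyForcingNumber G 0 = zeroForcingNumber G := by
  simp [leakyForcingNumber, zeroForcingNumber, IsLeakyForcingSet, IsZeroForcingSet]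

end LeakyForcing

/-! Write p = 1 for t odd and p = 2 for t even. Both bounds equal (n - 2)t + 2p, and Z_0 ≤ Z_1.
Lower bound: any matrix with the nonzero pattern of the adjacency matrix has nullity at most Z_0.
Take (g - g') ⊗ (S - S⁻¹), S the cyclic shift: its factors have ranks 2 and t - p
(`le_card_of_isZeroForcingSet`). Upper bound: color all vertices with g ≥ 2. What remains is K_2 ×
C_t, which is p disjoint cycles; color two adjacent vertices on each. Forcing runs around a cycle in
both directions, and one leak blocks only one of them (`colored_of_closed_walk`). -/

namespace LeakyForcing

/-! ### Forcing: kernel vectors, closed walks and comparison of the two numbers. -/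

section General

variable {V : Type*} {G : SimpleGraph V} {L B : Finset V}

/-- A vector in the kernel of a weighted adjacency matrix that vanishes on the initially colored
vertices vanishes on all vertices that are eventually colored. -/
theorem Colored.eq_zero_of_mem_ker [Fintype V] {A : V → V → ℝ}
    (hA : ∀ u w, A u w ≠ 0 ↔ G.Adj u w) {x : V → ℝ} (hx : ∀ u, ∑ w, A u w * x w = 0)
    (hB : ∀ v ∈ B, x v = 0) {v : V} (hv : Colored G L B v) : x v = 0 := by
  induction hv with
  | initial v hv => exact hB v hv
  | force u v hu hleak hadj hother _ ih =>
    have h := hx u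
    rw [Finset.sum_eq_single v] at h
    · exact (mul_eq_zero.mp h).resolve_left ((hA u v).mpr hadj)
    · intro w _ hwv
      by_cases hw : G.Adj u w
      · rw [ih w hw hwv, mul_zero]
      · rw [not_not.mp (mt (hA u w).mp hw), zero_mul]
    · simp

/-- If a closed walk of length `P` without repeated vertices has all other neighbors of its
vertices colored, and two consecutive vertices colored, then a single leak cannot stop the
forcing along it. -/
theorem colored_of_closed_walk (hL : L.card ≤ 1) {P : ℕ} {ψ : ℕ → V}
    (hP : ψ P = ψ 0) (hP' : ψ (P + 1) = ψ 1)
    (hinj : ∀ i j, 1 ≤ i → i < j → j ≤ P → ψ i ≠ ψ j)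
    (hadj : ∀ k, G.Adj (ψ k) (ψ (k + 1)))
    (hnb : ∀ k w, G.Adj (ψ (k + 1)) w → w = ψ k ∨ w = ψ (k + 2) ∨ Colored G L B w)
    (h0 : Colored G L B (ψ 0)) (h1 : Colored G L B (ψ 1)) {k : ℕ} (hk : k ≤ P) :
    Colored G L B (ψ k) := by
  have forward : ∀ k, (∀ j, 1 ≤ j → j ≤ k → ψ j ∉ L) →
      Colored G L B (ψ k) ∧ Colored G L B (ψ (k + 1)) := by
    intro k
    induction k with
    | zero => exact fun _ => ⟨h0, h1⟩
    | succ k ih =>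
      intro hj
      obtain ⟨c0, c1⟩ := ih fun j h1 h2 => hj j h1 (by omega)
      refine ⟨c1, .force _ _ c1 (hj _ (by omega) le_rfl) (hadj _) fun w hw hne => ?_⟩
      rcases hnb k w hw with rfl | rfl | h
      · exact c0
      · exact absurd rfl hne
      · exact h
  have backward : ∀ d, d ≤ P → (∀ j, P - d < j → j ≤ P → ψ j ∉ L) →
      Colored G L B (ψ (P - d)) ∧ Colored G L B (ψ (P - d + 1)) := by
    intro d
    induction d with
    | zero => exact fun _ _ => ⟨by simpa [hP] using h0, by simpa [hP'] using h1⟩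
    | succ d ih =>
      intro hd hj
      obtain ⟨c0, c1⟩ := ih (by omega) fun j h1 h2 => hj j (by omega) h2
      have e : P - d = P - (d + 1) + 1 := by omega
      rw [e] at c0 c1
      refine ⟨.force _ _ c0 (hj _ (by omega) (by omega)) (hadj _).symm fun w hw hne => ?_, c0⟩
      rcases hnb _ w hw with rfl | rfl | h
      · exact absurd rfl hne
      · exact c1
      · exact h
  -- An uncolored `ψ k` needs one leak before it and another after it; `hinj` makes them distinct.
  by_contra hcon
  have hf : ∃ i, 1 ≤ i ∧ i < k ∧ ψ i ∈ L := by
    by_contra! h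
    rcases k with _ | k
    · exact hcon h0
    · exact hcon (forward k fun j h1 h2 => h j h1 (by omega)).2
  have hb : ∃ j, k < j ∧ j ≤ P ∧ ψ j ∈ L := by
    by_contra! h
    have e : P - (P - k) = k := by omega
    have := (backward (P - k) (by omega) (by rwa [e])).1
    rw [e] at this
    exact hcon this
  obtain ⟨i, hi, hik, hiL⟩ := hf
  obtain ⟨j, hkj, hjP, hjL⟩ := hb
  exact hinj i j hi (by omega) hjP (Finset.card_le_one.mp hL _ hiL _ hjL)

theorem IsLeakyForcingSet.isZeroForcingSet {ℓ : ℕ} (h : IsLeakyForcingSet G ℓ B) :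
    IsZeroForcingSet G B :=
  h ∅ (by simp)

theorem leakyForcingNumber_le_card [Fintype V] {ℓ : ℕ} (h : IsLeakyForcingSet G ℓ B) :
    leakyForcingNumber G ℓ ≤ B.card :=
  Nat.sInf_le ⟨B, h, rfl⟩

theorem zeroForcingNumber_le_card [Fintype V] (h : IsZeroForcingSet G B) :
    zeroForcingNumber G ≤ B.card :=
  Nat.sInf_le ⟨B, h, rfl⟩

theorem exists_zeroForcingSet_card [Fintype V] (G : SimpleGraph V) :
    ∃ B : Finset V, IsZeroForcingSet G B ∧ B.card = zeroForcingNumber G :=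
  Nat.sInf_mem (s := {k | ∃ B : Finset V, IsZeroForcingSet G B ∧ B.card = k})
    ⟨_, Finset.univ, fun v => .initial v (Finset.mem_univ v), rfl⟩

theorem zeroForcingNumber_le_leakyForcingNumber [Fintype V] (G : SimpleGraph V) (ℓ : ℕ) :
    zeroForcingNumber G ≤ leakyForcingNumber G ℓ := by
  obtain ⟨B, hB, hcard⟩ := exists_leakyForcingSet_card G ℓ
  exact hcard ▸ zeroForcingNumber_le_card hB.isZeroForcingSet

end General

/-! ### Lower bound by the nullity of a weighted adjacency matrix. -/

section LowerBound

/-- A function on `Fin t` that is `p`-periodic away from the wrap-around, where `p` is `1`, or `2`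
with `t` even, takes equal values at the two cyclic neighbors of any index. -/
theorem apply_add_one_eq_apply_sub_one {s p : ℕ} (hp : p = 1 ∨ p = 2 ∧ Even (s + 3))
    {y : Fin (s + 3) → ℝ}
    (hy : ∀ j (hj : j + p < s + 3), y ⟨j + p, hj⟩ = y ⟨j, by omega⟩) (h : Fin (s + 3)) :
    y (h + 1) = y (h - 1) := by
  have hmod : ∀ q j (hj : q * p + j < s + 3), y ⟨q * p + j, hj⟩ = y ⟨j, by omega⟩ := by
    intro q
    induction q with
    | zero => intro j hj; congr 2; omega
    | succ q ih =>
      intro j hj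
      have e : (q + 1) * p + j = q * p + j + p := by ring
      rw [← ih j (by omega), ← hy (q * p + j) (by omega)]
      congr 2
  have key : ∀ i j : Fin (s + 3), i.val % p = j.val % p → y i = y j := by
    have aux : ∀ i : Fin (s + 3),
        y i = y ⟨i.val % p, (Nat.mod_le _ _).trans_lt i.isLt⟩ := by
      intro i
      have e : i.val / p * p + i.val % p = i.val := Nat.div_add_mod' _ _
      rw [← hmod (i.val / p) (i.val % p) (e.symm ▸ i.isLt)]
      congr 1
      exact Fin.ext e.symm
    intro i j hij
    rw [aux i, aux j]
    congr 2
  apply key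
  rcases hp with rfl | ⟨rfl, ht⟩
  · omega
  -- As t is even, wrapping around preserves parity.
  · have h1 : ((1 : Fin (s + 3)) : ℕ) = 1 := rfl
    have hlt := h.isLt
    rw [Fin.val_add, Fin.val_sub, h1]
    obtain ⟨r, hr⟩ := ht
    have hdvd : 2 ∣ s + 3 := ⟨r, by omega⟩
    rw [Nat.mod_mod_of_dvd _ hdvd, Nat.mod_mod_of_dvd _ hdvd]
    omega

/-- A weighted adjacency matrix of `K_n × C_t` of small rank. -/
def lowRankWeight (n s : ℕ) (u w : Fin n × Fin (s + 3)) : ℝ :=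
  ((u.1 : ℕ) - (w.1 : ℕ) : ℝ) *
    ((if w.2 = u.2 + 1 then 1 else 0) - (if w.2 = u.2 - 1 then 1 else 0))

theorem lowRankWeight_ne_zero_iff {n s : ℕ} (u w : Fin n × Fin (s + 3)) :
    lowRankWeight n s u w ≠ 0 ↔
      (directProduct (SimpleGraph.completeGraph (Fin n))
        (SimpleGraph.cycleGraph (s + 3))).Adj u w := by
  -- With t ≥ 3 the entries +1 and -1 sit in different places and cannot cancel.
  have hne : ∀ a : Fin (s + 3), a + 1 ≠ a - 1 := by
    intro a h
    have h2 : (1 : Fin (s + 3)) + 1 = 0 := by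
      have := congrArg (fun b => b - a + 1) h
      simpa [sub_eq_add_neg, add_assoc, add_comm, add_left_comm] using this
    have := congrArg Fin.val h2
    simp only [Fin.val_add, Fin.val_one, Fin.val_zero] at this
    rw [Nat.mod_eq_of_lt (by omega)] at this
    omega
  have e1 : u.2 - w.2 = 1 ↔ w.2 = u.2 - 1 := by
    constructor <;> intro h
    · rw [← h]; abel
    · rw [h]; abel
  have e2 : w.2 - u.2 = 1 ↔ w.2 = u.2 + 1 := by
    rw [sub_eq_iff_eq_add, add_comm 1]
  change _ ↔ u.1 ≠ w.1 ∧ (SimpleGraph.cycleGraph (s + 2 + 1)).Adj u.2 w.2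
  rw [SimpleGraph.cycleGraph_adj, e1, e2, lowRankWeight, mul_ne_zero_iff, sub_ne_zero,
    Nat.cast_inj.ne, Fin.val_inj.ne]
  refine and_congr_right fun _ => ?_
  by_cases h1 : w.2 = u.2 + 1
  · simp [h1, hne]
  · by_cases h2 : w.2 = u.2 - 1
    · simp [h2, (hne _).symm]
    · simp [h1, h2]

theorem sum_lowRankWeight_mul {n s : ℕ} (x : Fin n × Fin (s + 3) → ℝ)
    (u : Fin n × Fin (s + 3)) :
    ∑ w, lowRankWeight n s u w * x w =
      (u.1 : ℕ) * (∑ g, x (g, u.2 + 1) - ∑ g, x (g, u.2 - 1)) -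
        (∑ g : Fin n, (g : ℕ) * x (g, u.2 + 1) - ∑ g : Fin n, (g : ℕ) * x (g, u.2 - 1)) := by
  rw [Fintype.sum_prod_type]
  simp only [lowRankWeight, mul_sub, sub_mul, mul_ite, mul_one, mul_zero, ite_mul, zero_mul,
    Finset.sum_sub_distrib, Finset.sum_ite_eq', Finset.mem_univ, if_true, Finset.mul_sum]
  ring

/-- If the inequality failed, a nonzero `x` could vanish on `B` while its column sums, plain and
weighted by g, are p-periodic; such an `x` is in the kernel, a contradiction. -/
theorem le_card_of_isZeroForcingSet {n s p : ℕ} (hp : p = 1 ∨ p = 2 ∧ Even (s + 3))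
    {B : Finset (Fin n × Fin (s + 3))}
    (hB : IsZeroForcingSet (directProduct (SimpleGraph.completeGraph (Fin n))
      (SimpleGraph.cycleGraph (s + 3))) B) :
    n * (s + 3) ≤ B.card + 2 * (s + 3 - p) := by
  by_contra! hlt
  let layer (a : Fin n → ℝ) (h : Fin (s + 3)) : (Fin n × Fin (s + 3) → ℝ) →ₗ[ℝ] ℝ :=
    ∑ g, a g • LinearMap.proj (g, h)
  -- Only differences that do not wrap around are imposed, hence t - p conditions instead of t.
  let diff (a : Fin n → ℝ) : (Fin n × Fin (s + 3) → ℝ) →ₗ[ℝ] (Fin (s + 3 - p) → ℝ) :=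
    LinearMap.pi fun j => layer a ⟨j + p, by omega⟩ - layer a ⟨j, by omega⟩
  let T : (Fin n × Fin (s + 3) → ℝ) →ₗ[ℝ]
      (B → ℝ) × (Fin (s + 3 - p) → ℝ) × (Fin (s + 3 - p) → ℝ) :=
    (LinearMap.funLeft ℝ ℝ Subtype.val).prod
      ((diff fun _ => 1).prod (diff fun g => (g : ℕ)))
  have hker : LinearMap.ker T ≠ ⊥ := by
    apply LinearMap.ker_ne_bot_of_finrank_lt
    simp only [Module.finrank_prod, Module.finrank_fintype_fun_eq_card, Fintype.card_prod,
      Fintype.card_fin, Fintype.card_coe]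
    omega
  obtain ⟨x, hxT, hx0⟩ := (Submodule.ne_bot_iff _).mp hker
  rw [LinearMap.mem_ker] at hxT
  have hT1 : ∀ v ∈ B, x v = 0 := fun v hv => congrFun (congrArg Prod.fst hxT) ⟨v, hv⟩
  have hlayer : ∀ a : Fin n → ℝ, diff a x = 0 → ∀ h : Fin (s + 3),
      ∑ g, a g * x (g, h + 1) = ∑ g, a g * x (g, h - 1) := by
    intro a ha
    apply apply_add_one_eq_apply_sub_one hp (y := fun h => ∑ g, a g * x (g, h))
    intro j hj
    have := congrFun ha ⟨j, by omega⟩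
    simpa [diff, layer, sub_eq_zero] using this
  have hy := hlayer _ (congrArg (fun z => z.2.1) hxT)
  have hz := hlayer _ (congrArg (fun z => z.2.2) hxT)
  simp only [one_mul] at hy
  refine hx0 (funext fun v => (hB v).eq_zero_of_mem_ker lowRankWeight_ne_zero_iff
    (fun u => ?_) hT1)
  rw [sum_lowRankWeight_mul, hy, hz]
  ring

end LowerBound

/-! ### Upper bound by zigzag cycles in K_2 × C_t. -/

section UpperBound

/-- The walk `k ↦ (k + c mod 2, k mod t)` in the first two layers of `K_n × C_t`. -/
def zigzag (m s c k : ℕ) : Fin (m + 2) × Fin (s + 3) :=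
  (⟨(k + c) % 2, by omega⟩, ⟨k % (s + 3), Nat.mod_lt _ (by omega)⟩)

theorem zigzag_eq_iff {m s c k d l : ℕ} :
    zigzag m s c k = zigzag m s d l ↔
      (k + c) % 2 = (l + d) % 2 ∧ k % (s + 3) = l % (s + 3) := by
  simp [zigzag]

theorem zigzag_succ_snd (m s c k : ℕ) :
    (zigzag m s c (k + 1)).2 = (zigzag m s c k).2 + 1 :=
  Fin.ext (by simp [zigzag, Fin.val_add])

theorem directProduct_adj_zigzag_succ (m s c k : ℕ) :
    (directProduct (SimpleGraph.completeGraph (Fin (m + 2)))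
      (SimpleGraph.cycleGraph (s + 3))).Adj (zigzag m s c k) (zigzag m s c (k + 1)) := by
  constructor
  · change (zigzag m s c k).1 ≠ (zigzag m s c (k + 1)).1
    rw [Ne, Fin.ext_iff]
    simp only [zigzag]
    omega
  · change (SimpleGraph.cycleGraph (s + 2 + 1)).Adj _ _
    rw [SimpleGraph.cycleGraph_adj, zigzag_succ_snd]
    exact .inr (add_sub_cancel_left _ _)

theorem eq_zigzag_of_adj {m s c k : ℕ} {w : Fin (m + 2) × Fin (s + 3)}
    (hw : (directProduct (SimpleGraph.completeGraph (Fin (m + 2)))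
      (SimpleGraph.cycleGraph (s + 3))).Adj (zigzag m s c (k + 1)) w) :
    w = zigzag m s c k ∨ w = zigzag m s c (k + 2) ∨ 2 ≤ w.1.val := by
  obtain ⟨h1, h2⟩ := hw
  change (zigzag m s c (k + 1)).1 ≠ w.1 at h1
  rw [Ne, Fin.ext_iff] at h1
  simp only [zigzag] at h1
  change (SimpleGraph.cycleGraph (s + 2 + 1)).Adj _ _ at h2
  rw [SimpleGraph.cycleGraph_adj] at h2
  by_cases hge : 2 ≤ w.1.val
  · exact .inr (.inr hge)
  rcases h2 with h2 | h2
  · refine .inl (Prod.ext (Fin.ext ?_) ?_)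
    · simp only [zigzag]
      omega
    · rw [zigzag_succ_snd, sub_eq_iff_eq_add, add_comm 1] at h2
      exact (add_right_cancel h2).symm
  · refine .inr (.inl (Prod.ext (Fin.ext ?_) ?_))
    · simp only [zigzag]
      omega
    · rw [zigzag_succ_snd m s c (k + 1), sub_eq_iff_eq_add.mp h2]
      exact add_comm _ _

/-- All layers but the first two, together with the first two vertices of `p` zigzags. -/
def zigzagForcingSet (m s p : ℕ) : Finset (Fin (m + 2) × Fin (s + 3)) :=
  (Finset.univ.image fun a : Fin m × Fin (s + 3) => (a.1.natAdd 2 |>.cast (by omega), a.2)) ∪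
    (Finset.range p ×ˢ Finset.range 2).image fun a => zigzag m s a.1 a.2

theorem card_zigzagForcingSet_le (m s p : ℕ) :
    (zigzagForcingSet m s p).card ≤ m * (s + 3) + 2 * p := by
  refine (Finset.card_union_le _ _).trans (add_le_add ?_ ?_)
  · exact Finset.card_image_le.trans (by simp)
  · exact Finset.card_image_le.trans (by simp [mul_comm])

theorem mem_zigzagForcingSet_of_two_le {m s p : ℕ} {w : Fin (m + 2) × Fin (s + 3)}
    (hw : 2 ≤ w.1.val) : w ∈ zigzagForcingSet m s p := by
  refine Finset.mem_union_left _ (Finset.mem_image.mpr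
    ⟨(⟨w.1.val - 2, by omega⟩, w.2), Finset.mem_univ _, ?_⟩)
  refine Prod.ext (Fin.ext ?_) rfl
  simp
  omega

theorem zigzag_mem_zigzagForcingSet {m s p c k : ℕ} (hc : c < p) (hk : k < 2) :
    zigzag m s c k ∈ zigzagForcingSet m s p :=
  Finset.mem_union_right _ (Finset.mem_image.mpr ⟨(c, k), by simp [hc, hk], rfl⟩)

/-- The hypotheses say that `P` is the least common multiple of 2 and t, so the zigzag closes at `P`
and not before. -/
theorem colored_zigzag {m s p P c k : ℕ} (hc : c < p) (hP2 : P % 2 = 0)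
    (hPt : P % (s + 3) = 0) (hmin : ∀ d, 0 < d → d < P → d % 2 = 0 → d % (s + 3) ≠ 0)
    {L : Finset (Fin (m + 2) × Fin (s + 3))} (hL : L.card ≤ 1) (hk : k ≤ P) :
    Colored (directProduct (SimpleGraph.completeGraph (Fin (m + 2)))
      (SimpleGraph.cycleGraph (s + 3))) L (zigzagForcingSet m s p) (zigzag m s c k) := by
  refine colored_of_closed_walk (ψ := zigzag m s c) hL ?_ ?_ ?_
    (directProduct_adj_zigzag_succ m s c) ?_
    (.initial _ (zigzag_mem_zigzagForcingSet hc (by omega)))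
    (.initial _ (zigzag_mem_zigzagForcingSet hc (by omega))) hk
  · exact zigzag_eq_iff.mpr ⟨by omega, by simp [hPt]⟩
  · exact zigzag_eq_iff.mpr ⟨by omega, by rw [Nat.add_mod, hPt]; simp⟩
  · intro i j hi hij hj h
    obtain ⟨h1, h2⟩ := zigzag_eq_iff.mp h
    refine hmin (j - i) (by omega) (by omega) (by omega) ?_
    exact Nat.sub_mod_eq_zero_of_mod_eq h2.symm
  · intro k w hw
    rcases eq_zigzag_of_adj hw with h | h | h
    · exact .inl h
    · exact .inr (.inl h)
    · exact .inr (.inr (.initial _ (mem_zigzagForcingSet_of_two_le h)))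

theorem isLeakyForcingSet_zigzagForcingSet_one {m s : ℕ} (hodd : Odd (s + 3)) :
    IsLeakyForcingSet (directProduct (SimpleGraph.completeGraph (Fin (m + 2)))
      (SimpleGraph.cycleGraph (s + 3))) 1 (zigzagForcingSet m s 1) := by
  intro L hL v
  by_cases hv : 2 ≤ v.1.val
  · exact .initial _ (mem_zigzagForcingSet_of_two_le hv)
  have ht : (s + 3) % 2 = 1 := Nat.odd_iff.mp hodd
  have hlt := v.2.isLt
  have hcol : ∀ k, k ≤ 2 * (s + 3) → Colored _ L _ (zigzag m s 0 k) := fun k hk =>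
    colored_zigzag (p := 1) (by omega) (by omega) (by simp) (fun d h0 hd h2 h3 => by
      have hdvd : 2 * (s + 3) ∣ d :=
        Nat.Coprime.mul_dvd_of_dvd_of_dvd (Nat.coprime_two_left.mpr hodd)
          (Nat.dvd_of_mod_eq_zero h2) (Nat.dvd_of_mod_eq_zero h3)
      exact absurd (Nat.le_of_dvd h0 hdvd) (by omega)) hL hk
  by_cases hpar : v.2.val % 2 = v.1.val
  · have e : v = zigzag m s 0 v.2.val :=
      Prod.ext (Fin.ext (by simp [zigzag, hpar]))
        (Fin.ext (by simp [zigzag, Nat.mod_eq_of_lt hlt]))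
    rw [e]
    exact hcol _ (by omega)
  -- For t odd, the second lap meets each column in the other parity.
  · have e : v = zigzag m s 0 (v.2.val + (s + 3)) :=
      Prod.ext (Fin.ext (by simp only [zigzag]; omega))
        (Fin.ext (by simp only [zigzag, Nat.add_mod_right, Nat.mod_eq_of_lt hlt]))
    rw [e]
    exact hcol _ (by omega)

theorem isLeakyForcingSet_zigzagForcingSet_two {m s : ℕ} (heven : Even (s + 3)) :
    IsLeakyForcingSet (directProduct (SimpleGraph.completeGraph (Fin (m + 2)))
      (SimpleGraph.cycleGraph (s + 3))) 1 (zigzagForcingSet m s 2) := by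
  intro L hL v
  by_cases hv : 2 ≤ v.1.val
  · exact .initial _ (mem_zigzagForcingSet_of_two_le hv)
  have hlt := v.2.isLt
  -- For t even, the parity of g + h is constant along a zigzag and tells which of the two cycles
  -- contains `v`.
  have e : v = zigzag m s ((v.1.val + v.2.val) % 2) v.2.val :=
    Prod.ext (Fin.ext (by simp only [zigzag]; omega))
      (Fin.ext (by simp [zigzag, Nat.mod_eq_of_lt hlt]))
  rw [e]
  exact colored_zigzag (P := s + 3) (by omega) (Nat.even_iff.mp heven) (by simp)
    (fun d h0 hd _ => by rw [Nat.mod_eq_of_lt hd]; omega) hL (by omega)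

end UpperBound

end LeakyForcing

theorem theorem2p3 (n t : ℕ) (hn : 2 ≤ n) (ht : 3 ≤ t) :
    LeakyForcing.IsResilient
        (LeakyForcing.directProduct (SimpleGraph.completeGraph (Fin n)) (SimpleGraph.cycleGraph t)) 1 ∧
      LeakyForcing.leakyForcingNumber
          (LeakyForcing.directProduct (SimpleGraph.completeGraph (Fin n)) (SimpleGraph.cycleGraph t)) 1 =
        (if Odd t then (n - 2) * t + 2 else (n - 2) * t + 4) ∧
      LeakyForcing.zeroForcingNumber
          (LeakyForcing.directProduct (SimpleGraph.completeGraph (Fin n)) (SimpleGraph.cycleGraph t)) =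
        (if Odd t then (n - 2) * t + 2 else (n - 2) * t + 4) := by
  obtain ⟨m, rfl⟩ := Nat.exists_eq_add_of_le' hn
  obtain ⟨s, rfl⟩ := Nat.exists_eq_add_of_le' ht
  rw [LeakyForcing.IsResilient, Nat.add_sub_cancel]
  have hle := LeakyForcing.zeroForcingNumber_le_leakyForcingNumber
    (LeakyForcing.directProduct (SimpleGraph.completeGraph (Fin (m + 2)))
      (SimpleGraph.cycleGraph (s + 3))) 1
  obtain ⟨B, hB, hcard⟩ := LeakyForcing.exists_zeroForcingSet_card
    (LeakyForcing.directProduct (SimpleGraph.completeGraph (Fin (m + 2)))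
      (SimpleGraph.cycleGraph (s + 3)))
  have hmul : (m + 2) * (s + 3) = m * (s + 3) + 2 * (s + 3) := by ring
  split_ifs with hodd
  · have lower := LeakyForcing.le_card_of_isZeroForcingSet (.inl rfl) hB
    have upper := (LeakyForcing.leakyForcingNumber_le_card
      (LeakyForcing.isLeakyForcingSet_zigzagForcingSet_one (m := m) hodd)).trans
      (LeakyForcing.card_zigzagForcingSet_le m s 1)
    omega
  · have heven := Nat.not_odd_iff_even.mp hodd
    have lower := LeakyForcing.le_card_of_isZeroForcingSet (.inr ⟨rfl, heven⟩) hB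
    have upper := (LeakyForcing.leakyForcingNumber_le_card
      (LeakyForcing.isLeakyForcingSet_zigzagForcingSet_two (m := m) heven)).trans
      (LeakyForcing.card_zigzagForcingSet_le m s 2)
    omega
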